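/- Let $F^*$ be a countable (finite or infinite) set, let $(Q_{i,j})_{i\neq j\in F^*}$ be non-negative transition rates, let $p_0:F^*\to[0,\infty)$ and let $N\ge 2$ be an integer. Assume (A) $\ \mathbf{Q_1}=\sup_{i\in F^*}\sum_{j\neq i}Q_{i,j}<\infty$ and $\mathbf{p}=\sup_{i\in F^*}p_0(i)<\infty$. Let $E=\{\eta:F^*\to\mathbb N \mid \sum_{i\in F^*}\eta(i)=N\}$ and let $$\mathcal L f(\eta)=\sum_{i\in F^*}\eta(i)\sum_{j\in F^*}\bigl(f(T_{i\to j}\eta)-f(\eta)\bigr)\Bigl(Q_{i,j}+p_0(i)\frac{\eta(j)}{N-1}\Bigr),$$ for bounded $f:E\to\mathbb R$, where $T_{i\to j}\eta$ (for $\eta(i)\ne0$) is obtained from $\eta$ by moving one particle from site $i$ to site $j$ (in particular $T_{i\to i}\eta=\eta$, so that the terms $j=i$ vanish). Set $$\rho=\lambda-\bigl(\sup p_0-\inf p_0\bigr),\qquad \lambda=\inf_{i\neq i'}\Bigl(Q_{i,i'}+Q_{i',i}+\sum_{j\neq i,i'}\min(Q_{i,j},Q_{i',j})\Bigr),$$ with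 $\lambda=0$ if $F^*$ has only one site. Let $\eta_0\in E$ and let $(\eta_t)_{t\ge0}$ be the Fleming–Viot process generated by $\mathcal L$ and started from $\eta_0$: an $E$-valued adapted process on a filtered probability space, with càdlàg paths for the discrete topology of $E$, equal to $\eta_0$ almost surely at time $0$, such that $f(\eta_t)-\int_0^t\mathcal L f(\eta_s)\,ds$ is a martingale for every bounded $f:E\to\mathbb R$. Then for all $k,l\in F^*$ and all $t\ge0$, $$\left|\mathbb E\Bigl[\frac{\eta_t(k)}N\frac{\eta_t(l)}N\Bigr]-\mathbb E\Bigl[\frac{\eta_t(k)}N\Bigr]\mathbb E\Bigl[\frac{\eta_t(l)}N\Bigr]\right|\le\frac{2(\mathbf{Q_1}+\mathbf p)}{N-1}\cdot\frac{1-e^{-2\rho t}}{\rho},$$ where $(1-e^{-2\rho t})/\rho$ is read as $2t$ when $\rho=0$. -/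

import Mathlib

open MeasureTheory ProbabilityTheory Filter Topology
open scoped NNReal

namespace FlemingViot

/-- Configurations `η : F → ℕ` of `N` particles on the sites `F`, that is `∑ i, η i = N`
(so that `η` has finite support). -/
abbrev Config (F : Type*) (N : ℕ) : Type _ := {η : F →₀ ℕ // η.sum (fun _ n => n) = N}

/-- Removing one particle from an occupied site `i` and adding one at `j` preserves the total
number of particles. -/
theorem sum_move {F : Type*} (η : F →₀ ℕ) (i j : F) (h : η i ≠ 0) :
    (η - Finsupp.single i 1 + Finsupp.single j 1).sum (fun _ n => n) = η.sum (fun _ n => n) := by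
  have hle : Finsupp.single i 1 ≤ η := by
    rw [Finsupp.single_le_iff]
    omega
  have hη : η - Finsupp.single i 1 + Finsupp.single i 1 = η := tsub_add_cancel_of_le hle
  have key : ∀ k : F, (η - Finsupp.single i 1 + Finsupp.single k 1).sum (fun _ n => n)
      = (η - Finsupp.single i 1).sum (fun _ n => n) + 1 := by
    intro k
    rw [Finsupp.sum_add_index' (fun _ => rfl) (fun _ _ _ => rfl)]
    simp
  have hi := key i
  rw [hη] at hi
  rw [key j, hi]

open Classical in
/-- `move i j η` is the configuration obtained from `η` when a particle jumps from `i` to `j`.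
If there is no particle at `i`, we put `move i j η = η`. -/
noncomputable def move {F : Type*} {N : ℕ} (i j : F) (η : Config F N) : Config F N :=
  if h : η.1 i = 0 then η
  else ⟨η.1 - Finsupp.single i 1 + Finsupp.single j 1, (sum_move η.1 i j h).trans η.2⟩

/-- The generator of the `N`-particle system with rates `Q` and death rate `p₀`.
The diagonal of `Q` plays no role, since `move i i η = η`. -/
noncomputable def generator {F : Type*} (Q : F → F → ℝ) (p₀ : F → ℝ) {N : ℕ}
    (f : Config F N → ℝ) (η : Config F N) : ℝ :=
  ∑ i ∈ η.1.support, (η.1 i : ℝ) *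
    ∑' j : F, (f (move i j η) - f η) * (Q i j + p₀ i * ((η.1 j : ℝ) / ((N : ℝ) - 1)))

/-- The Markov jump process `η` generated by `generator Q p₀` and started from `η₀`: a process
adapted to the filtration `ℱ`, with càdlàg paths in the discrete space of configurations,
which solves the martingale problem for all bounded test functions. -/
structure IsProcess {F : Type*} (Q : F → F → ℝ) (p₀ : F → ℝ) {N : ℕ} {Ω : Type*}
    [mΩ : MeasurableSpace Ω] (μ : Measure Ω) (ℱ : Filtration ℝ≥0 mΩ)
    (η : ℝ≥0 → Ω → Config F N) (η₀ : Config F N) : Prop where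
  adapted : ∀ t : ℝ≥0, Measurable[ℱ t, ⊤] (η t)
  right_continuous : ∀ ω : Ω, ∀ t : ℝ≥0, ∀ᶠ s in 𝓝[>] t, η s ω = η t ω
  left_limits : ∀ ω : Ω, ∀ t : ℝ≥0, ∃ ξ : Config F N, ∀ᶠ s in 𝓝[<] t, η s ω = ξ
  initial : ∀ᵐ ω ∂μ, η 0 ω = η₀
  martingale : ∀ f : Config F N → ℝ, (∃ C : ℝ, ∀ ξ, |f ξ| ≤ C) →
    Martingale (fun (t : ℝ≥0) (ω : Ω) =>
      f (η t ω) - ∫ s in (0 : ℝ)..(t : ℝ), generator Q p₀ f (η s.toNNReal ω)) ℱ μ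

/-- The total rate `∑_{j ≠ i} Q i j` at which the underlying chain leaves `i`. -/
noncomputable def exitRate {F : Type*} (Q : F → F → ℝ) (i : F) : ℝ :=
  ∑' j : {j : F // j ≠ i}, Q i j

/-- The exit rates and the death rates are finite and bounded. -/
structure BoundedRates {F : Type*} (Q : F → F → ℝ) (p₀ : F → ℝ) : Prop where
  summable : ∀ i : F, Summable (fun j : {j : F // j ≠ i} => Q i j)
  exitRate_bdd : BddAbove (Set.range (exitRate Q))
  death_bdd : BddAbove (Set.range p₀)

/-- `Q₁ = sup_i ∑_{j ≠ i} Q i j`. -/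
noncomputable def Q₁ {F : Type*} (Q : F → F → ℝ) : ℝ := ⨆ i : F, exitRate Q i

/-- `λ = inf_{i ≠ i'} (Q i i' + Q i' i + ∑_{j ≠ i, i'} min (Q i j) (Q i' j))`
(equal to `0` when there are no two distinct sites). -/
noncomputable def mixingRate {F : Type*} (Q : F → F → ℝ) : ℝ :=
  ⨅ x : {x : F × F // x.1 ≠ x.2}, (Q x.1.1 x.1.2 + Q x.1.2 x.1.1 +
    ∑' j : {j : F // j ≠ x.1.1 ∧ j ≠ x.1.2}, min (Q x.1.1 j) (Q x.1.2 j))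

/-- `ρ = λ - (sup p₀ - inf p₀)`. -/
noncomputable def rho {F : Type*} (Q : F → F → ℝ) (p₀ : F → ℝ) : ℝ :=
  mixingRate Q - ((⨆ i : F, p₀ i) - ⨅ i : F, p₀ i)

/-- `(1 - exp (-2 ρ t)) / ρ`, read as `2 t` when `ρ = 0`. -/
noncomputable def timeFactor (ρ t : ℝ) : ℝ :=
  if ρ = 0 then 2 * t else (1 - Real.exp (-2 * ρ * t)) / ρ

end FlemingViot

/-!
The rates are bounded, so the generator `L` is a bounded operator on the Banach algebra of bounded
functions of configurations, and it generates the semigroup `S_t = exp (t L)`. Taking expectations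
in the martingale problem yields `𝔼[f(η_t)] = f(η₀) + ∫₀ᵗ 𝔼[L f(η_s)] ds`, which forces
`𝔼[f(η_t)] = (S_t f)(η₀)` (`IsProcess.integral_comp_eq_semigroup`).

The covariance of `u(η_t)` and `v(η_t)` is therefore `(S_t(uv) - S_t u S_t v)(η₀)`, which equals
`∫₀ᵗ S_{t-s} Γ(S_s u, S_s v)(η₀) ds` with the carré du champ `Γ(u, v) = L(uv) - u L v - v L u`
(`abs_covariance_le`). Since `Γ(u, v)` is a sum over jumps of products of increments of `u` and `v`,
it is at most the total jump rate, of order `N (Q₁ + sup p₀)`, times the Lipschitz constants of `u`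
and `v` under the move of one particle (`norm_carreDuChamp_le`). For the densities `η(k) / N` these
constants are `1 / N`.

It remains to see that `S_s` contracts the Lipschitz constant by `exp (-ρ s)`
(`moveLipschitz_semigroup`). Two configurations one move apart have the form `y + δ_a` and
`y + δ_b`. Comparing the generator at both, jump by jump, as in a coupling, shows that the particles
at `a` and `b` merge at rate at least `λ + inf p₀`, while the common particles cause a separation at
rate at most `sup p₀` (`RateBounds.drift_sub_add_le`). This says that `L + M`, for a large constant
`M`, multiplies Lipschitz constants by at most `M - ρ`, and the power series of `exp (t (L + M))`
turns it into the contraction of the semigroup (`semigroup_le_of_forall_generator_le`).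
-/

namespace FlemingViot

/-! ### The semigroup of a bounded operator -/

section Semigroup

variable {V : Type*} [NormedAddCommGroup V] [NormedSpace ℝ V]

/-- The semigroup `exp (t L)` of a bounded operator `L`. -/
noncomputable def semigroup (L : V →L[ℝ] V) (t : ℝ) : V →L[ℝ] V := NormedSpace.exp (t • L)

theorem semigroup_zero_apply (L : V →L[ℝ] V) (w : V) : semigroup L 0 w = w := by
  simp [semigroup]

variable [CompleteSpace V]

/-- Product rule for `r ↦ exp (c(r) L) w(r)`. -/
theorem hasDerivAt_semigroup_apply (L : V →L[ℝ] V) {c : ℝ → ℝ} {c' s : ℝ} (hc : HasDerivAt c c' s)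
    {w : ℝ → V} {w' : V} (hw : HasDerivAt w w' s) :
    HasDerivAt (fun r => semigroup L (c r) (w r))
      (semigroup L (c s) (c' • L (w s) + w')) s := by
  have h1 : HasDerivAt (fun r => semigroup L (c r))
      (c' • (semigroup L (c s) * L)) s :=
    (hasDerivAt_exp_smul_const L (c s)).scomp s hc
  have h2 := h1.clm_apply hw
  convert h2 using 1
  simp [map_add]

theorem hasDerivAt_semigroup (L : V →L[ℝ] V) (w : V) (s : ℝ) :
    HasDerivAt (fun r => semigroup L r w) (L (semigroup L s w)) s := by
  have h1 := (hasDerivAt_exp_smul_const' (𝕂 := ℝ) L s).clm_apply (hasDerivAt_const s w)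
  refine h1.congr_deriv ?_
  simp [semigroup]

/-- A family `Φ` of functionals of norm at most `1` that solves the integrated forward equation
`Φ_t = Φ_0 + ∫₀ᵗ Φ_s ∘ L ds` is `Φ_t = Φ_0 ∘ exp (t L)`. The equation makes `Φ` Lipschitz in
operator norm, hence differentiable, and then `s ↦ Φ_s (exp ((t - s) L) f)` has zero derivative. -/
theorem eq_comp_semigroup_of_integral_eq (L : V →L[ℝ] V) (Φ : ℝ → V →L[ℝ] ℝ) (hb : ∀ s, ‖Φ s‖ ≤ 1)
    (hm : ∀ g, Measurable fun s => Φ s g)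
    (h : ∀ t, 0 ≤ t → ∀ g, Φ t g = Φ 0 g + ∫ s in (0 : ℝ)..t, Φ s (L g)) {t : ℝ} (ht : 0 ≤ t) :
    Φ t = (Φ 0).comp (semigroup L t) := by
  have hbd : ∀ s g, ‖Φ s g‖ ≤ ‖g‖ := fun s g =>
    ((Φ s).le_of_opNorm_le (hb s) g).trans_eq (one_mul _)
  have hint : ∀ g a b, IntervalIntegrable (fun s => Φ s g) volume a b := by
    intro g a b
    refine IntervalIntegrable.mono_fun' (g := fun _ => ‖g‖) (by simp) (hm g).aestronglyMeasurable ?_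
    exact Eventually.of_forall fun s => hbd s g
  have hlip : ∀ s r, 0 ≤ s → 0 ≤ r → ‖Φ s - Φ r‖ ≤ ‖L‖ * |s - r| := by
    intro s r hs hr
    refine ContinuousLinearMap.opNorm_le_bound _ (by positivity) fun g => ?_
    rw [sub_apply, h s hs, h r hr, add_sub_add_left_eq_sub,
      intervalIntegral.integral_interval_sub_left (hint _ _ _) (hint _ _ _)]
    refine (intervalIntegral.norm_integral_le_of_norm_le_const (C := ‖L‖ * ‖g‖)
      fun x _ => (hbd x _).trans (L.le_opNorm g)).trans_eq (by ring)
  -- Extending `Φ` by `Φ 0` to negative times makes it continuous on the whole line.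
  have hcont : Continuous fun s => Φ (max s 0) := by
    refine LipschitzWith.continuous (K := ‖L‖₊) (LipschitzWith.of_dist_le_mul fun s r => ?_)
    rw [dist_eq_norm, Real.dist_eq]
    refine (hlip _ _ (le_max_right _ _) (le_max_right _ _)).trans ?_
    exact mul_le_mul_of_nonneg_left (abs_max_sub_max_le_abs _ _ _) (norm_nonneg _)
  have hcont' : Continuous fun s => (Φ (max s 0)).comp L := hcont.clm_comp continuous_const
  set X : ℝ → V →L[ℝ] ℝ := fun s => Φ 0 + ∫ r in (0 : ℝ)..s, (Φ (max r 0)).comp L with hX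
  have hXd : ∀ s, HasDerivAt X ((Φ (max s 0)).comp L) s := fun s =>
    (hcont'.integral_hasStrictDerivAt 0 s).hasDerivAt.const_add _
  have hXΦ : ∀ s, 0 ≤ s → X s = Φ s := by
    intro s hs
    ext g
    rw [h s hs, hX]
    simp only [add_apply]
    rw [ContinuousLinearMap.intervalIntegral_apply (hcont'.intervalIntegrable _ _)]
    congr 1
    refine intervalIntegral.integral_congr fun r hr => ?_
    rw [Set.uIcc_of_le hs] at hr
    simp [max_eq_left hr.1]
  ext f
  have hG : ∀ s, 0 ≤ s → HasDerivAt (fun r => X r (semigroup L (t - r) f)) 0 s := by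
    intro s hs
    have h1 := hasDerivAt_semigroup_apply L ((hasDerivAt_id s).const_sub t) (hasDerivAt_const s f)
    have h2 := (hXd s).clm_apply h1
    refine h2.congr_deriv ?_
    have hcomm : ∀ c : ℝ, semigroup L c (L f) = L (semigroup L c f) := by
      intro c
      have : Commute (semigroup L c) L :=
        by
        rw [semigroup]
        exact ((Commute.refl L).smul_left c).exp_left
      exact congrArg (fun A : V →L[ℝ] V => A f) this
    rw [hXΦ s hs, max_eq_left hs]
    simp [hcomm]
  have := constant_of_has_deriv_right_zero (a := 0) (b := t)
    (fun s hs => (hG s hs.1).continuousAt.continuousWithinAt)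
    (fun s hs => (hG s hs.1).hasDerivWithinAt) t ⟨ht, le_rfl⟩
  simp only [sub_self, semigroup_zero_apply, sub_zero, hXΦ t ht, hXΦ 0 le_rfl] at this
  simpa using this

theorem semigroup_eq_exp_smul_semigroup_add (L : V →L[ℝ] V) (M t : ℝ) :
    semigroup L t = Real.exp (-(t * M)) • semigroup (L + M • (1 : V →L[ℝ] V)) t := by
  let _ : NormedAlgebra ℚ (V →L[ℝ] V) := NormedAlgebra.restrictScalars ℚ ℝ _
  have h1 : t • L = algebraMap ℝ (V →L[ℝ] V) (-(t * M)) + t • (L + M • (1 : V →L[ℝ] V)) := by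
    rw [Algebra.algebraMap_eq_smul_one]
    module
  rw [semigroup, semigroup, h1, NormedSpace.exp_add_of_commute (Algebra.commutes _ _),
    ← NormedSpace.algebraMap_exp_comm, ← Algebra.smul_def, Real.exp_eq_exp_ℝ]

/-- If `L + M` multiplies every common upper bound of the functionals `d i` by at most
`M - ρ`, then `exp (t L)` multiplies it by at most `exp (-ρ t)`: expand
`exp (t L) = exp (-t M) exp (t (L + M))` as a power series in `L + M`. -/
theorem semigroup_le_of_forall_generator_le {ι : Type*} (L : V →L[ℝ] V)
    (d : ι → V →L[ℝ] ℝ) (M ρ : ℝ)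
    (hL : ∀ u K, (∀ i, d i u ≤ K) → ∀ i, d i (L u) + M * d i u ≤ (M - ρ) * K)
    {u : V} {K : ℝ} (hu : ∀ i, d i u ≤ K) {t : ℝ} (ht : 0 ≤ t) (i : ι) :
    d i (semigroup L t u) ≤ Real.exp (-ρ * t) * K := by
  set A : V →L[ℝ] V := L + M • (1 : V →L[ℝ] V) with hA
  have hAd : ∀ i w, d i (A w) = d i (L w) + M * d i w := fun i w => by
    simp [hA]
  have hpow : ∀ n i, d i ((A ^ n) u) ≤ (M - ρ) ^ n * K := by
    intro n
    induction n with
    | zero => simpa using hu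
    | succ n ih =>
      intro i
      rw [pow_succ', pow_succ', mul_assoc, mul_apply_eq_comp, hAd]
      exact hL _ _ ih i
  have h1 := ((d i).comp (ContinuousLinearMap.apply ℝ V u)).hasSum
      (NormedSpace.exp_series_hasSum_exp' (𝕂 := ℝ) (t • A))
  have h2 := (NormedSpace.exp_series_hasSum_exp' (𝕂 := ℝ) (t * (M - ρ))).mul_right K
  rw [← Real.exp_eq_exp_ℝ] at h2
  have h3 : d i (semigroup A t u) ≤ Real.exp (t * (M - ρ)) * K := by
    refine hasSum_le (fun n => ?_) h1 h2
    have := mul_le_mul_of_nonneg_left (hpow n i)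
      (show 0 ≤ (n.factorial : ℝ)⁻¹ * t ^ n by positivity)
    rw [smul_pow, smul_smul]
    simp only [ContinuousLinearMap.comp_apply, ContinuousLinearMap.apply_apply, map_smul,
      smul_eq_mul, mul_pow]
    linarith
  rw [semigroup_eq_exp_smul_semigroup_add L M t, smul_apply, map_smul, smul_eq_mul]
  refine (mul_le_mul_of_nonneg_left h3 (Real.exp_nonneg _)).trans_eq ?_
  rw [← mul_assoc, ← Real.exp_add]
  congr 2
  ring

end Semigroup

/-! ### The time factor -/

theorem hasDerivAt_timeFactor (ρ s : ℝ) :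
    HasDerivAt (timeFactor ρ) (2 * Real.exp (-2 * ρ * s)) s := by
  unfold timeFactor
  by_cases h : ρ = 0
  · simpa [h] using (hasDerivAt_id s).const_mul 2
  · simp only [h, if_false]
    have h1 := ((((hasDerivAt_id s).const_mul (-2 * ρ)).exp).const_sub 1).div_const ρ
    refine h1.congr_deriv ?_
    simp only [id]
    field_simp

theorem timeFactor_zero (ρ : ℝ) : timeFactor ρ 0 = 0 := by simp [timeFactor]

theorem timeFactor_nonneg (ρ : ℝ) {t : ℝ} (ht : 0 ≤ t) : 0 ≤ timeFactor ρ t := by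
  have hmono : Monotone (timeFactor ρ) := monotone_of_hasDerivAt_nonneg
    (fun s => hasDerivAt_timeFactor ρ s) (fun s => by positivity)
  simpa [timeFactor_zero] using hmono ht

/-! ### Covariances and the carré du champ -/

section CarreDuChamp

variable {A : Type*} [NormedCommRing A] [NormedAlgebra ℝ A] [CompleteSpace A]

/-- The carré du champ `Γ(u, v) = L(uv) - u L v - v L u` of `L`. -/
noncomputable def carreDuChamp (L : A →L[ℝ] A) (u v : A) : A := L (u * v) - u * L v - L u * v

/-- The covariance `S_t(uv) - S_t u S_t v` under the character `φ` is the integral over `s ∈ [0, t]`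
of `S_{t-s} Γ(S_s u, S_s v)`, because the integrand is minus the derivative of
`s ↦ S_{t-s}(S_s u S_s v)`. So exponential decay of `Γ(S_s u, S_s v)` bounds it. -/
theorem abs_covariance_le (L : A →L[ℝ] A) (φ : A →L[ℝ] ℝ) (hφ : ∀ u v, φ (u * v) = φ u * φ v)
    {C ρ t : ℝ} (ht : 0 ≤ t)
    (hS : ∀ s : ℝ, 0 ≤ s → ∀ g, |φ (semigroup L s g)| ≤ ‖g‖) {u v : A}
    (hΓ : ∀ s, 0 ≤ s → ‖carreDuChamp L (semigroup L s u) (semigroup L s v)‖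
      ≤ C * Real.exp (-2 * ρ * s)) :
    |φ (semigroup L t (u * v))
      - φ (semigroup L t u) * φ (semigroup L t v)|
      ≤ C / 2 * timeFactor ρ t := by
  set S : ℝ → A →L[ℝ] A := fun s => semigroup L s with hSdef
  set h : ℝ → ℝ := fun s => φ (S t (u * v)) - φ (S (t - s) (S s u * S s v)) with hh
  have hflow : ∀ w s, HasDerivAt (fun r => S r w) (L (S s w)) s := by
    intro w s
    exact hasDerivAt_semigroup L w s
  have hd : ∀ s, HasDerivAt h (φ (S (t - s) (carreDuChamp L (S s u) (S s v)))) s := by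
    intro s
    have h1 := hasDerivAt_semigroup_apply L ((hasDerivAt_id s).const_sub t)
      ((hflow u s).mul (hflow v s))
    have h2 := (φ.hasFDerivAt.comp_hasDerivAt s h1).const_sub (φ (S t (u * v)))
    refine h2.congr_deriv ?_
    rw [← map_neg, ← map_neg]
    simp only [hSdef, carreDuChamp, id]
    congr 2
    simp only [Pi.mul_apply, neg_smul, one_smul]
    abel
  have := image_norm_le_of_norm_deriv_right_le_deriv_boundary (f := h) (a := 0) (b := t)
    (B := fun s => C / 2 * timeFactor ρ s)
    (fun s _ => (hd s).continuousAt.continuousWithinAt) (fun s _ => (hd s).hasDerivWithinAt)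
    (by simp only [hh, hSdef, sub_zero, semigroup_zero_apply]; simp [timeFactor_zero])
    (fun s => (hasDerivAt_timeFactor ρ s).const_mul (C / 2))
    (fun s hs => by
      refine (hS _ (sub_nonneg.2 hs.2.le) _).trans ((hΓ s hs.1).trans_eq ?_)
      ring) (x := t) ⟨ht, le_rfl⟩
  simpa only [hh, hSdef, sub_self, semigroup_zero_apply, hφ, Real.norm_eq_abs] using this

end CarreDuChamp

/-! ### The law of the process -/

/-- The points of the grid of mesh `1 / (n + 1)` immediately to the right of `s` tend to `s`
strictly from the right. -/
theorem tendsto_floor_succ_div_nhdsGT (s : ℝ≥0) :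
    Tendsto (fun n : ℕ => ((⌊((n : ℝ≥0) + 1) * s⌋₊ : ℝ≥0) + 1) / ((n : ℝ≥0) + 1)) atTop
      (𝓝[>] s) := by
  have hpos : ∀ n : ℕ, (0 : ℝ≥0) < (n : ℝ≥0) + 1 := fun n => by positivity
  refine tendsto_nhdsWithin_iff.2 ⟨?_, Eventually.of_forall fun n => ?_⟩
  · have hlim : Tendsto (fun n : ℕ => s + 1 / ((n : ℝ≥0) + 1)) atTop (𝓝 s) := by
      simpa using tendsto_const_nhds.add (tendsto_one_div_add_atTop_nhds_zero_nat (𝕜 := ℝ≥0))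
    refine tendsto_of_tendsto_of_tendsto_of_le_of_le tendsto_const_nhds hlim (fun n => ?_)
      fun n => ?_
    · rw [le_div_iff₀ (hpos n), mul_comm]
      exact (Nat.lt_floor_add_one _).le
    · rw [add_div]
      refine add_le_add ?_ le_rfl
      rw [div_le_iff₀ (hpos n), mul_comm s]
      exact Nat.floor_le zero_le
  · rw [Set.mem_Ioi, lt_div_iff₀ (hpos n), mul_comm]
    exact Nat.lt_floor_add_one _

/-- A process with right-continuous paths is jointly measurable, as the limit of its
discretizations on grids. -/
theorem measurable_uncurry_of_rightContinuous {Ω : Type*} [MeasurableSpace Ω] {Y : ℝ≥0 → Ω → ℝ}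
    (hY : ∀ s, Measurable (Y s)) (hc : ∀ ω s, ContinuousWithinAt (fun r => Y r ω) (Set.Ioi s) s) :
    Measurable (Function.uncurry Y) := by
  obtain ⟨d, hd⟩ : ∃ d : ℕ → ℕ → ℝ≥0, ∀ n k, d n k = ((k : ℝ≥0) + 1) / ((n : ℝ≥0) + 1) :=
    ⟨_, fun _ _ => rfl⟩
  have hlim : ∀ s : ℝ≥0, Tendsto (fun n : ℕ => d n ⌊((n : ℝ≥0) + 1) * s⌋₊) atTop (𝓝[>] s) := by
    simpa only [hd] using tendsto_floor_succ_div_nhdsGT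
  have hmeas : ∀ n : ℕ, Measurable fun x : ℝ≥0 × Ω => Y (d n ⌊((n : ℝ≥0) + 1) * x.1⌋₊) x.2 := by
    intro n
    have h1 : Measurable fun y : ℕ × Ω => Y (d n y.1) y.2 :=
      measurable_from_prod_countable_right fun k => hY (d n k)
    have h2 : Measurable fun x : ℝ≥0 × Ω => (⌊((n : ℝ≥0) + 1) * x.1⌋₊, x.2) :=
      (Nat.measurable_floor.comp (measurable_fst.const_mul _)).prodMk measurable_snd
    exact h1.comp h2
  exact measurable_of_tendsto_metrizable hmeas
    (tendsto_pi_nhds.2 fun x => (hc x.2 x.1).tendsto.comp (hlim x.1))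

open scoped BoundedContinuousFunction

section Law

variable {F : Type*} {Q : F → F → ℝ} {p₀ : F → ℝ} {N : ℕ} {Ω : Type*} [mΩ : MeasurableSpace Ω]
  {μ : Measure Ω} {ℱ : Filtration ℝ≥0 mΩ} {η : ℝ≥0 → Ω → Config F N} {η₀ : Config F N}

theorem IsProcess.measurable_comp (hη : IsProcess Q p₀ μ ℱ η η₀) (f : Config F N → ℝ) (s : ℝ≥0) :
    Measurable fun ω => f (η s ω) := by
  have h : Measurable[ℱ s] fun ω => f (η s ω) :=
    (measurable_from_top (f := f)).comp (hη.adapted s)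
  exact h.mono (ℱ.le s) le_rfl

theorem IsProcess.measurable_uncurry (hη : IsProcess Q p₀ μ ℱ η η₀) (f : Config F N → ℝ) :
    Measurable fun x : ℝ × Ω => f (η x.1.toNNReal x.2) := by
  have h : Measurable (Function.uncurry fun s ω => f (η s ω)) :=
    measurable_uncurry_of_rightContinuous (hη.measurable_comp f) fun ω s => by
      refine tendsto_const_nhds.congr' ?_
      filter_upwards [hη.right_continuous ω s] with r hr
      simp only [hr]
  exact h.comp ((measurable_real_toNNReal.comp measurable_fst).prodMk measurable_snd)

variable [IsProbabilityMeasure μ]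

theorem IsProcess.integrable_comp (hη : IsProcess Q p₀ μ ℱ η η₀) {f : Config F N → ℝ} {C : ℝ}
    (hf : ∀ ξ, |f ξ| ≤ C) (s : ℝ≥0) : Integrable (fun ω => f (η s ω)) μ :=
  Integrable.of_bound (hη.measurable_comp f s).aestronglyMeasurable C
    (Eventually.of_forall fun _ => hf _)

/-- Dynkin's formula: the martingale problem in expectation, after an exchange of integrals. -/
theorem IsProcess.integral_comp_eq (hη : IsProcess Q p₀ μ ℱ η η₀) {f : Config F N → ℝ} {C C' : ℝ}
    (hf : ∀ ξ, |f ξ| ≤ C) (hg : ∀ ξ, |generator Q p₀ f ξ| ≤ C') {t : ℝ} (ht : 0 ≤ t) :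
    ∫ ω, f (η t.toNNReal ω) ∂μ =
      f η₀ + ∫ s in (0 : ℝ)..t, ∫ ω, generator Q p₀ f (η s.toNNReal ω) ∂μ := by
  have hM := hη.martingale f ⟨C, hf⟩
  have h0 := hM.setIntegral_eq (zero_le (a := t.toNNReal)) MeasurableSet.univ
  simp only [Measure.restrict_univ, Real.coe_toNNReal _ ht, NNReal.coe_zero,
    intervalIntegral.integral_same, sub_zero] at h0
  have hinit : ∫ ω, f (η 0 ω) ∂μ = f η₀ := by
    have : (fun ω => f (η 0 ω)) =ᵐ[μ] fun _ => f η₀ := by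
      filter_upwards [hη.initial] with ω hω
      rw [hω]
    rw [integral_congr_ae this]
    simp
  have : IsFiniteMeasure (volume.restrict (Set.uIoc 0 t)) :=
    isFiniteMeasure_restrict.2 (by simp [Set.uIoc_of_le ht])
  have hprod : Integrable (Function.uncurry fun (s : ℝ) ω => generator Q p₀ f (η s.toNNReal ω))
      ((volume.restrict (Set.uIoc 0 t)).prod μ) :=
    Integrable.of_bound (hη.measurable_uncurry (generator Q p₀ f)).aestronglyMeasurable C'
      (Eventually.of_forall fun _ => hg _)
  have hfub := intervalIntegral_integral_swap hprod
  have hint : Integrable (fun ω => ∫ s in (0 : ℝ)..t, generator Q p₀ f (η s.toNNReal ω)) μ := by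
    have h1 := hM.integrable t.toNNReal
    have h2 := (hη.integrable_comp hf t.toNNReal).sub h1
    refine h2.congr (Eventually.of_forall fun ω => ?_)
    simp [Real.coe_toNNReal _ ht]
  rw [integral_sub (hη.integrable_comp hf _) hint, hinit] at h0
  rw [hfub]
  linarith

variable [TopologicalSpace (Config F N)]

/-- The law of `η_s`, seen as the functional `f ↦ 𝔼[f(η_s)]` on bounded functions. -/
noncomputable def IsProcess.expectation [DiscreteTopology (Config F N)]
    (hη : IsProcess Q p₀ μ ℱ η η₀) (s : ℝ≥0) :
    (Config F N →ᵇ ℝ) →L[ℝ] ℝ :=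
  LinearMap.mkContinuous
    { toFun := fun f => ∫ ω, f (η s ω) ∂μ
      map_add' := fun f g => integral_add (hη.integrable_comp f.norm_coe_le_norm s)
        (hη.integrable_comp g.norm_coe_le_norm s)
      map_smul' := fun c f => integral_const_mul c _ } 1 fun f => by
    have := norm_integral_le_of_norm_le_const (μ := μ) (f := fun ω => f (η s ω)) (C := ‖f‖)
      (Eventually.of_forall fun ω => f.norm_coe_le_norm _)
    simpa using this

variable [DiscreteTopology (Config F N)]

theorem IsProcess.expectation_apply (hη : IsProcess Q p₀ μ ℱ η η₀) (s : ℝ≥0)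
    (f : Config F N →ᵇ ℝ) : hη.expectation s f = ∫ ω, f (η s ω) ∂μ := rfl

theorem IsProcess.norm_expectation_le (hη : IsProcess Q p₀ μ ℱ η η₀) (s : ℝ≥0) :
    ‖hη.expectation s‖ ≤ 1 := LinearMap.mkContinuous_norm_le _ zero_le_one _

/-- When the generator acts as a bounded operator `L`, the law of `η_t` is determined by
`𝔼[f(η_t)] = (exp (t L) f)(η₀)`. -/
theorem IsProcess.integral_comp_eq_semigroup (hη : IsProcess Q p₀ μ ℱ η η₀)
    (L : (Config F N →ᵇ ℝ) →L[ℝ] (Config F N →ᵇ ℝ)) (hL : ∀ f ξ, L f ξ = generator Q p₀ f ξ)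
    (t : ℝ≥0) (f : Config F N →ᵇ ℝ) :
    ∫ ω, f (η t ω) ∂μ = semigroup L t f η₀ := by
  have hg : ∀ f : Config F N →ᵇ ℝ, ∀ ξ, |generator Q p₀ f ξ| ≤ ‖L f‖ := fun f ξ => by
    rw [← hL]
    exact (L f).norm_coe_le_norm ξ
  have h0 : ∀ g : Config F N →ᵇ ℝ, hη.expectation 0 g = g η₀ := fun g => by
    have := hη.integral_comp_eq g.norm_coe_le_norm (hg g) le_rfl
    simpa [expectation_apply] using this
  have h1 := eq_comp_semigroup_of_integral_eq L (fun s : ℝ => hη.expectation s.toNNReal)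
    (fun s => hη.norm_expectation_le _)
    (fun g => by
      have h : StronglyMeasurable (Function.uncurry fun (s : ℝ) ω => g (η s.toNNReal ω)) :=
        (hη.measurable_uncurry g).stronglyMeasurable
      exact h.integral_prod_right.measurable)
    (fun t ht g => by
      rw [Real.toNNReal_zero, h0, expectation_apply,
        hη.integral_comp_eq g.norm_coe_le_norm (hg g) ht]
      simp only [expectation_apply, hL]) t.coe_nonneg
  have h2 := congrArg (fun φ : (Config F N →ᵇ ℝ) →L[ℝ] ℝ => φ f) h1
  simpa [h0, expectation_apply] using h2

end Law

/-! ### The generator on finitely supported functions -/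

open Finsupp

section Drift

variable {F : Type*}

/-- Jump rates `q` with zero diagonal, row sums at most `B`, and death rates at most `P`. -/
structure RateBounds (q : F → F → ℝ) (p : F → ℝ) (B P : ℝ) : Prop where
  nonneg : ∀ i j, 0 ≤ q i j
  diag : ∀ i, q i i = 0
  summable : ∀ i, Summable (q i)
  tsum_le : ∀ i, ∑' j, q i j ≤ B
  death_nonneg : ∀ i, 0 ≤ p i
  death_le : ∀ i, p i ≤ P

/-- The rate at which a given particle at `i` jumps to `j` in the configuration `x`; the constant
`c` stands for `N - 1`. -/
noncomputable def jumpRate (q : F → F → ℝ) (p : F → ℝ) (c : ℝ) (x : F →₀ ℕ) (i j : F) : ℝ :=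
  q i j + p i * ((x j : ℝ) / c)

/-- The contribution to the generator of a single particle located at `i`. -/
noncomputable def siteDrift (q : F → F → ℝ) (p : F → ℝ) (c : ℝ) (f : (F →₀ ℕ) → ℝ) (x : F →₀ ℕ)
    (i : F) : ℝ :=
  ∑' j, (f (x - single i 1 + single j 1) - f x) * jumpRate q p c x i j

/-- The generator, acting on functions of all finitely supported `x : F →₀ ℕ`. -/
noncomputable def drift (q : F → F → ℝ) (p : F → ℝ) (c : ℝ) (f : (F →₀ ℕ) → ℝ) (x : F →₀ ℕ) : ℝ :=
  x.sum fun i n => (n : ℝ) * siteDrift q p c f x i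

theorem hasSum_coe (x : F →₀ ℕ) : HasSum (fun j => (x j : ℝ)) (x.degree : ℝ) := by
  rw [degree_apply, Nat.cast_sum]
  refine hasSum_sum_of_ne_finset_zero fun j hj => ?_
  simpa using hj

theorem summable_mul_of_abs_le {ι : Type*} {g w : ι → ℝ} {D : ℝ} (hg : ∀ j, |g j| ≤ D)
    (hw : ∀ j, 0 ≤ w j) (hs : Summable w) : Summable fun j => g j * w j := by
  refine Summable.of_norm_bounded (hs.mul_left D) fun j => ?_
  rw [Real.norm_eq_abs, abs_mul, abs_of_nonneg (hw j)]
  exact mul_le_mul_of_nonneg_right (hg j) (hw j)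

theorem abs_tsum_mul_le {ι : Type*} {g w : ι → ℝ} {D : ℝ} (hg : ∀ j, |g j| ≤ D)
    (hw : ∀ j, 0 ≤ w j) (hs : Summable w) : |∑' j, g j * w j| ≤ D * ∑' j, w j := by
  rw [← Real.norm_eq_abs]
  refine tsum_of_norm_bounded (hs.hasSum.mul_left D) fun j => ?_
  rw [Real.norm_eq_abs, abs_mul, abs_of_nonneg (hw j)]
  exact mul_le_mul_of_nonneg_right (hg j) (hw j)

variable {q : F → F → ℝ} {p : F → ℝ} {B P c : ℝ}

theorem RateBounds.hasSum_jumpRate (h : RateBounds q p B P) (c : ℝ) (x : F →₀ ℕ) (i : F) :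
    HasSum (jumpRate q p c x i) (∑' j, q i j + p i * (x.degree / c)) :=
  (h.summable i).hasSum.add (((hasSum_coe x).div_const c).mul_left (p i))

theorem RateBounds.jumpRate_nonneg (h : RateBounds q p B P) (hc : 0 < c) (x : F →₀ ℕ) (i j : F) :
    0 ≤ jumpRate q p c x i j :=
  add_nonneg (h.nonneg i j) (mul_nonneg (h.death_nonneg i) (by positivity))

theorem RateBounds.tsum_jumpRate_le (h : RateBounds q p B P) (hc : 0 < c) (x : F →₀ ℕ) (i : F) :
    ∑' j, jumpRate q p c x i j ≤ B + P * (x.degree / c) := by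
  rw [(h.hasSum_jumpRate c x i).tsum_eq]
  exact add_le_add (h.tsum_le i) (mul_le_mul_of_nonneg_right (h.death_le i) (by positivity))

theorem RateBounds.summable_siteDrift (h : RateBounds q p B P) (hc : 0 < c)
    {f : (F →₀ ℕ) → ℝ} {C : ℝ} (hf : ∀ x, |f x| ≤ C) (x : F →₀ ℕ) (i : F) :
    Summable fun j => (f (x - single i 1 + single j 1) - f x) * jumpRate q p c x i j :=
  summable_mul_of_abs_le (D := C + C) (fun _ => (abs_sub _ _).trans (add_le_add (hf _) (hf _)))
    (fun j => h.jumpRate_nonneg hc x i j) (h.hasSum_jumpRate c x i).summable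

/-- A weighted sum over the particles of `x` is at most the number of particles times a bound for
the weights. -/
theorem abs_sum_le_degree_mul (x : F →₀ ℕ) {g : F → ℝ} {D : ℝ} (hg : ∀ i, x i ≠ 0 → |g i| ≤ D) :
    |x.sum fun i n => (n : ℝ) * g i| ≤ x.degree * D := by
  rw [degree_apply, Nat.cast_sum, Finset.sum_mul]
  refine (Finset.abs_sum_le_sum_abs _ _).trans (Finset.sum_le_sum fun i hi => ?_)
  rw [abs_mul, Nat.abs_cast]
  exact mul_le_mul_of_nonneg_left (hg i (mem_support_iff.1 hi)) (Nat.cast_nonneg _)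

theorem RateBounds.abs_drift_le (h : RateBounds q p B P) (hc : 0 < c)
    {f : (F →₀ ℕ) → ℝ} {C : ℝ} (hf : ∀ x, |f x| ≤ C) (x : F →₀ ℕ) :
    |drift q p c f x| ≤ x.degree * ((C + C) * (B + P * (x.degree / c))) := by
  have hC : 0 ≤ C := (abs_nonneg _).trans (hf x)
  refine abs_sum_le_degree_mul x fun i _ => ?_
  refine (abs_tsum_mul_le (D := C + C)
    (fun _ => (abs_sub _ _).trans (add_le_add (hf _) (hf _)))
    (fun j => h.jumpRate_nonneg hc x i j) (h.hasSum_jumpRate c x i).summable).trans ?_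
  exact mul_le_mul_of_nonneg_left (h.tsum_jumpRate_le hc x i) (by positivity)

theorem RateBounds.drift_add (h : RateBounds q p B P) (hc : 0 < c)
    {f g : (F →₀ ℕ) → ℝ} {C C' : ℝ} (hf : ∀ x, |f x| ≤ C) (hg : ∀ x, |g x| ≤ C') (x : F →₀ ℕ) :
    drift q p c (fun y => f y + g y) x = drift q p c f x + drift q p c g x := by
  simp only [drift, Finsupp.sum]
  rw [← Finset.sum_add_distrib]
  refine Finset.sum_congr rfl fun i _ => ?_
  rw [← mul_add, siteDrift, siteDrift, siteDrift,
    ← (h.summable_siteDrift hc hf x i).tsum_add (h.summable_siteDrift hc hg x i)]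
  congr 2
  ext j
  ring

theorem drift_const_mul (r : ℝ) (f : (F →₀ ℕ) → ℝ) (x : F →₀ ℕ) :
    drift q p c (fun y => r * f y) x = r * drift q p c f x := by
  simp only [drift, Finsupp.sum]
  rw [Finset.mul_sum]
  refine Finset.sum_congr rfl fun i _ => ?_
  have hsite : siteDrift q p c (fun y => r * f y) x i = r * siteDrift q p c f x i := by
    rw [siteDrift, siteDrift, ← tsum_mul_left]
    exact tsum_congr fun j => by ring
  rw [hsite]
  ring

/-- The carré du champ of the generator is a sum over jumps of products of increments. -/
theorem RateBounds.drift_mul (h : RateBounds q p B P) (hc : 0 < c)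
    {f g : (F →₀ ℕ) → ℝ} {C C' : ℝ} (hf : ∀ x, |f x| ≤ C) (hg : ∀ x, |g x| ≤ C') (x : F →₀ ℕ) :
    drift q p c (fun y => f y * g y) x - f x * drift q p c g x - drift q p c f x * g x =
      x.sum fun i n => (n : ℝ) * ∑' j, ((f (x - single i 1 + single j 1) - f x) *
        (g (x - single i 1 + single j 1) - g x)) * jumpRate q p c x i j := by
  have hC : 0 ≤ C := (abs_nonneg _).trans (hf x)
  simp only [drift, Finsupp.sum]
  rw [Finset.mul_sum, Finset.sum_mul, ← Finset.sum_sub_distrib, ← Finset.sum_sub_distrib]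
  refine Finset.sum_congr rfl fun i _ => ?_
  have hfg : ∀ y, |f y * g y| ≤ C * C' := fun y => by
    rw [abs_mul]
    exact mul_le_mul (hf y) (hg y) (abs_nonneg _) hC
  have h1 := h.summable_siteDrift hc hfg x i
  have h2 := (h.summable_siteDrift hc hg x i).mul_left (f x)
  have h3 := (h.summable_siteDrift hc hf x i).mul_left (g x)
  have key : siteDrift q p c (fun y => f y * g y) x i - f x * siteDrift q p c g x i
      - g x * siteDrift q p c f x i = ∑' j, ((f (x - single i 1 + single j 1) - f x) *
        (g (x - single i 1 + single j 1) - g x)) * jumpRate q p c x i j := by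
    rw [siteDrift, siteDrift, siteDrift, ← tsum_mul_left, ← tsum_mul_left, ← h1.tsum_sub h2,
      ← (h1.sub h2).tsum_sub h3]
    congr 1
    ext j
    ring
  rw [← key]
  ring

/-! ### The carré du champ of functions that are Lipschitz under moves -/

theorem sub_add_cancel_single {x : F →₀ ℕ} {i : F} (hi : x i ≠ 0) :
    x - single i 1 + single i 1 = x :=
  tsub_add_cancel_of_le (by rw [single_le_iff]; omega)

theorem degree_sub_single {x : F →₀ ℕ} {i : F} (hi : x i ≠ 0) :
    (x - single i 1).degree + 1 = x.degree := by
  conv_rhs => rw [← sub_add_cancel_single hi]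
  simp

/-- `f` varies by at most `K` when one particle is moved, the remaining particles forming a
configuration of `n` particles. -/
def MoveLipschitz (f : (F →₀ ℕ) → ℝ) (n : ℕ) (K : ℝ) : Prop :=
  ∀ y : F →₀ ℕ, y.degree = n → ∀ a b, f (y + single a 1) - f (y + single b 1) ≤ K

theorem MoveLipschitz.abs_le {f : (F →₀ ℕ) → ℝ} {n : ℕ} {K : ℝ} (hf : MoveLipschitz f n K)
    {y : F →₀ ℕ} (hy : y.degree = n) (a b : F) :
    |f (y + single a 1) - f (y + single b 1)| ≤ K :=
  abs_le'.2 ⟨hf y hy a b, by rw [neg_sub]; exact hf y hy b a⟩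

/-- The carré du champ is at most a bound for the total jump rate times the product of the
Lipschitz constants. -/
theorem RateBounds.abs_drift_mul_le (h : RateBounds q p B P) (hc : 0 < c)
    {f g : (F →₀ ℕ) → ℝ} {C C' K K' : ℝ} (hf : ∀ x, |f x| ≤ C) (hg : ∀ x, |g x| ≤ C') {n : ℕ}
    (hfK : MoveLipschitz f n K) (hgK : MoveLipschitz g n K') (hK : 0 ≤ K) (hK' : 0 ≤ K')
    {x : F →₀ ℕ} (hx : x.degree = n + 1) :
    |drift q p c (fun y => f y * g y) x - f x * drift q p c g x - drift q p c f x * g x|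
      ≤ x.degree * (K * K' * (B + P * (x.degree / c))) := by
  rw [h.drift_mul hc hf hg]
  refine abs_sum_le_degree_mul x fun i hi => ?_
  have hy : (x - single i 1).degree = n := by
    have := degree_sub_single hi
    omega
  refine (abs_tsum_mul_le (D := K * K') (fun j => ?_)
    (fun j => h.jumpRate_nonneg hc x i j) (h.hasSum_jumpRate c x i).summable).trans
    (mul_le_mul_of_nonneg_left (h.tsum_jumpRate_le hc x i) (by positivity))
  have h1 := hfK.abs_le hy j i
  have h2 := hgK.abs_le hy j i
  rw [sub_add_cancel_single hi] at h1 h2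
  rw [abs_mul]
  exact mul_le_mul h1 h2 (abs_nonneg _) hK

/-! ### Contraction between configurations that differ by one move -/

open Classical in
theorem jumpRate_add_single (q : F → F → ℝ) (p : F → ℝ) (c : ℝ) (y : F →₀ ℕ) (a i j : F) :
    jumpRate q p c (y + single a 1) i j = jumpRate q p c y i j + if j = a then p i / c else 0 := by
  simp only [jumpRate, Finsupp.add_apply, single_apply, eq_comm (a := a)]
  split_ifs
  · push_cast
    ring
  · simp

/-- Drift due to a particle at `i` common to the configurations `y + δ_a` and `y + δ_b`. Let the
common particle make the same jump in both: this keeps them one move apart, except that the extra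
particle at `a` (respectively `b`) attracts it with rate `p i / n`, which leads to two moves. Hence
the additional term `P / n * K`. -/
theorem RateBounds.siteDrift_sub_le_of_common (h : RateBounds q p B P)
    {f : (F →₀ ℕ) → ℝ} {C K : ℝ} (hf : ∀ x, |f x| ≤ C) {n : ℕ} (hn : 0 < n)
    (hfK : MoveLipschitz f n K) {y : F →₀ ℕ} (hy : y.degree = n) {i : F} (hi : y i ≠ 0) (a b : F) :
    siteDrift q p n f (y + single a 1) i - siteDrift q p n f (y + single b 1) i ≤
      (B + P + P / n) * (K - (f (y + single a 1) - f (y + single b 1))) + P / n * K := by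
  classical
  have hc : (0 : ℝ) < n := by exact_mod_cast hn
  set D := f (y + single a 1) - f (y + single b 1) with hD
  have hDK : D ≤ K := hfK y hy a b
  have hK : 0 ≤ K := (abs_nonneg _).trans (hfK.abs_le hy a b)
  -- `z` collects the particles other than the moving one at `i` and the one at `a` or `b`.
  set z := y - single i 1 with hz
  have hyz : z + single i 1 = y := sub_add_cancel_single hi
  have hzd : z.degree + 1 = n := by rw [hz, degree_sub_single hi, hy]
  have hmove : ∀ a j : F, y + single a 1 - single i 1 + single j 1
      = z + single j 1 + single a 1 := by
    intro a j
    have : y + single a 1 - single i 1 = z + single a 1 := by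
      rw [← hyz, add_right_comm, add_tsub_cancel_right]
    rw [this, add_right_comm]
  have hzj : ∀ j, (z + single j 1).degree = n := fun j => by simpa using hzd
  have hT := (h.summable_siteDrift hc hf (y + single a 1) i).hasSum.sub
    (h.summable_siteDrift hc hf (y + single b 1) i).hasSum
  set Ga := f (z + single a 1 + single a 1) - f (y + single a 1)
  set Gb := f (z + single b 1 + single b 1) - f (y + single b 1)
  have hR : HasSum (fun j => jumpRate q p n y i j * (K - D)
      + ((if j = a then p i / n * Ga else 0) - if j = b then p i / n * Gb else 0))
      ((∑' j, q i j + p i * (y.degree / n)) * (K - D) + (p i / n * Ga - p i / n * Gb)) :=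
    ((h.hasSum_jumpRate _ y i).mul_right _).add ((hasSum_ite_eq a _).sub (hasSum_ite_eq b _))
  have hle := hasSum_le (fun j => ?_) hT hR
  · rw [siteDrift, siteDrift]
    refine hle.trans ?_
    have hG : Ga - Gb ≤ 2 * K - D := by
      have h1 := hfK (z + single a 1) (hzj a) a b
      have h2 := hfK (z + single b 1) (hzj b) a b
      rw [add_right_comm z (single b 1)] at h2
      simp only [Ga, Gb, hD]
      linarith
    rw [hy, div_self hc.ne', mul_one, ← mul_sub]
    have h1 : (∑' j, q i j + p i) * (K - D) ≤ (B + P) * (K - D) :=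
      mul_le_mul_of_nonneg_right (add_le_add (h.tsum_le i) (h.death_le i)) (by linarith)
    have h2 : p i / n * (Ga - Gb) ≤ P / n * (2 * K - D) :=
      (mul_le_mul_of_nonneg_left hG (div_nonneg (h.death_nonneg i) hc.le)).trans
        (mul_le_mul_of_nonneg_right (div_le_div_of_nonneg_right (h.death_le i) hc.le) (by linarith))
    linarith
  · have h1 : f (z + single j 1 + single a 1) - f (z + single j 1 + single b 1) ≤ K :=
      hfK _ (hzj j) a b
    have h2 := mul_le_mul_of_nonneg_left h1 (h.jumpRate_nonneg hc y i j)
    simp only [hmove, jumpRate_add_single]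
    have ha : (f (z + single j 1 + single a 1) - f (y + single a 1)) *
        (if j = a then p i / n else 0) = if j = a then p i / n * Ga else 0 := by
      split_ifs with hj
      · subst hj
        exact mul_comm _ _
      · simp
    have hb : (f (z + single j 1 + single b 1) - f (y + single b 1)) *
        (if j = b then p i / n else 0) = if j = b then p i / n * Gb else 0 := by
      split_ifs with hj
      · subst hj
        exact mul_comm _ _
      · simp
    rw [mul_add, mul_add, ha, hb]
    simp only [hD]
    linarith

/-- Drift due to the particle at which `y + δ_a` and `y + δ_b` differ. Let the particles at `a` and
`b` jump together to `j` as often as the rates allow. The configurations then merge at rate at least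
`q a b + q b a + ∑ⱼ min (q a j) (q b j) + pm`, and otherwise stay one move apart. -/
theorem RateBounds.siteDrift_sub_le_of_ne (h : RateBounds q p B P)
    {f : (F →₀ ℕ) → ℝ} {C K pm : ℝ} (hf : ∀ x, |f x| ≤ C) (hpm0 : 0 ≤ pm) (hpm : ∀ i, pm ≤ p i)
    {n : ℕ} (hn : 0 < n) (hfK : MoveLipschitz f n K) {y : F →₀ ℕ} (hy : y.degree = n) {a b : F}
    (hab : a ≠ b) :
    siteDrift q p n f (y + single a 1) a - siteDrift q p n f (y + single b 1) b ≤
      (2 * B + 2 * P) * (K - (f (y + single a 1) - f (y + single b 1)))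
        - (q a b + q b a + ∑' j, min (q a j) (q b j) + pm) * K := by
  classical
  have hc : (0 : ℝ) < n := by exact_mod_cast hn
  set D := f (y + single a 1) - f (y + single b 1) with hD
  have hDK : D ≤ K := hfK y hy a b
  have hK : 0 ≤ K := (abs_nonneg _).trans (hfK.abs_le hy a b)
  have hT := (h.summable_siteDrift hc hf (y + single a 1) a).hasSum.sub
    (h.summable_siteDrift hc hf (y + single b 1) b).hasSum
  have hmin : Summable fun j => min (q a j) (q b j) :=
    Summable.of_nonneg_of_le (fun j => le_min (h.nonneg a j) (h.nonneg b j))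
      (fun j => min_le_left _ _) (h.summable a)
  have hR : HasSum (fun j => (jumpRate q p n y a j + jumpRate q p n y b j) * (K - D)
      - ((if j = b then q a b else 0) + (if j = a then q b a else 0) + min (q a j) (q b j)
        + pm * (y j / n)) * K)
      (((∑' j, q a j + p a * (y.degree / n)) + (∑' j, q b j + p b * (y.degree / n))) * (K - D)
      - (q a b + q b a + ∑' j, min (q a j) (q b j) + pm * (y.degree / n)) * K) :=
    (((h.hasSum_jumpRate _ y a).add (h.hasSum_jumpRate _ y b)).mul_right _).sub
      (((((hasSum_ite_eq b _).add (hasSum_ite_eq a _)).add hmin.hasSum).add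
        (((hasSum_coe y).div_const _).mul_left pm)).mul_right K)
  have hle := hasSum_le (fun j => ?_) hT hR
  · rw [siteDrift, siteDrift]
    refine hle.trans ?_
    rw [hy, div_self hc.ne', mul_one, mul_one, mul_one]
    refine sub_le_sub_right (mul_le_mul_of_nonneg_right ?_ (by linarith)) _
    linarith [h.tsum_le a, h.tsum_le b, h.death_le a, h.death_le b]
  · have hcancel : ∀ a : F, y + single a 1 - single a 1 = y := fun a => add_tsub_cancel_right _ _
    have hA : f (y + single j 1) - f (y + single a 1) ≤ K - D := by
      have := hfK y hy j b
      simp only [hD]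
      linarith
    have hB : f (y + single b 1) - f (y + single j 1) ≤ K - D := by
      have := hfK y hy a j
      simp only [hD]
      linarith
    have hα : pm * (y j / n) ≤ p a * (y j / n) :=
      mul_le_mul_of_nonneg_right (hpm a) (by positivity)
    have hβ : pm * (y j / n) ≤ p b * (y j / n) :=
      mul_le_mul_of_nonneg_right (hpm b) (by positivity)
    have hαq := h.jumpRate_nonneg hc y a j
    have hβq := h.jumpRate_nonneg hc y b j
    simp only [hcancel]
    -- At `j = a` or `j = b` one of the two particles joins the other, and the configurations merge.
    by_cases hja : j = a
    · subst hja
      have hqm : min (q j j) (q b j) = 0 := by rw [h.diag, min_eq_left (h.nonneg b j)]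
      rw [jumpRate_add_single q p n y b, if_neg hab, if_neg hab, if_pos rfl, hqm]
      have e1 : (f (y + single j 1) - f (y + single b 1)) = D := rfl
      rw [e1, sub_self, zero_mul, add_zero]
      have e2 : q b j + pm * (y j / n) ≤ jumpRate q p n y b j := by
        rw [jumpRate]
        linarith
      have := mul_le_mul_of_nonneg_right e2 hK
      have := mul_nonneg hαq (sub_nonneg.2 hDK)
      linarith
    by_cases hjb : j = b
    · subst hjb
      have hqm : min (q a j) (q j j) = 0 := by rw [h.diag, min_eq_right (h.nonneg a j)]
      rw [jumpRate_add_single q p n y a, if_neg hja, if_neg hja, if_pos rfl, hqm]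
      have e1 : f (y + single j 1) - f (y + single a 1) = -D := by simp only [hD]; ring
      rw [e1, sub_self, zero_mul, add_zero]
      have e2 : q a j + pm * (y j / n) ≤ jumpRate q p n y a j := by
        rw [jumpRate]
        linarith
      have := mul_le_mul_of_nonneg_right e2 hK
      have := mul_nonneg hβq (sub_nonneg.2 hDK)
      linarith
    rw [jumpRate_add_single, jumpRate_add_single, if_neg hja, if_neg hjb, if_neg hja, if_neg hjb]
    simp only [add_zero, zero_add]
    set α := jumpRate q p n y a j with hαd
    set β := jumpRate q p n y b j with hβd
    -- `m` is a rate at which both particles can jump to `j` together.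
    set m := min (q a j) (q b j) + pm * (y j / n) with hm
    have hmα : m ≤ α := by
      rw [hαd, jumpRate, hm]
      linarith [min_le_left (q a j) (q b j)]
    have hmβ : m ≤ β := by
      rw [hβd, jumpRate, hm]
      linarith [min_le_right (q a j) (q b j)]
    have e1 := mul_le_mul_of_nonneg_left hA (sub_nonneg.2 hmα)
    have e2 := mul_le_mul_of_nonneg_left hB (sub_nonneg.2 hmβ)
    have hm0 : 0 ≤ m := add_nonneg (le_min (h.nonneg a j) (h.nonneg b j)) (by positivity)
    have e3 := mul_nonneg hm0 (sub_nonneg.2 hDK)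
    have e4 : m * (f (y + single b 1) - f (y + single a 1)) = - (m * D) := by
      simp only [hD]
      ring
    linarith

theorem drift_add_single (f : (F →₀ ℕ) → ℝ) (y : F →₀ ℕ) (a : F) :
    drift q p c f (y + single a 1) =
      (y.sum fun i m => (m : ℝ) * siteDrift q p c f (y + single a 1) i)
        + siteDrift q p c f (y + single a 1) a := by
  rw [drift, sum_add_index' (fun i => by simp) (fun i m m' => by push_cast; ring),
    sum_single_index (by simp), Nat.cast_one, one_mul]

/-- Contraction of the one-move Lipschitz constant, in the form required by
`semigroup_le_of_forall_generator_le`. -/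
theorem RateBounds.drift_sub_add_le (h : RateBounds q p B P)
    {f : (F →₀ ℕ) → ℝ} {C K pm : ℝ} (hf : ∀ x, |f x| ≤ C) (hpm0 : 0 ≤ pm) (hpm : ∀ i, pm ≤ p i)
    {n : ℕ} (hn : 0 < n) (hfK : MoveLipschitz f n K) {y : F →₀ ℕ} (hy : y.degree = n) {a b : F}
    (hab : a ≠ b) :
    drift q p n f (y + single a 1) - drift q p n f (y + single b 1)
      + (n * (B + P + P / n) + (2 * B + 2 * P)) * (f (y + single a 1) - f (y + single b 1)) ≤
      (n * (B + P + P / n) + (2 * B + 2 * P)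
        - (q a b + q b a + ∑' j, min (q a j) (q b j) - (P - pm))) * K := by
  have hc : (0 : ℝ) < n := by exact_mod_cast hn
  have hcommon : (y.sum fun i m => (m : ℝ) * siteDrift q p n f (y + single a 1) i)
      - (y.sum fun i m => (m : ℝ) * siteDrift q p n f (y + single b 1) i) ≤
      n * ((B + P + P / n) * (K - (f (y + single a 1) - f (y + single b 1))) + P / n * K) := by
    have hsum : ∀ R : ℝ, n * R = ∑ i ∈ y.support, (y i : ℝ) * R := fun R => by
      rw [← Finset.sum_mul, ← Nat.cast_sum, ← degree_apply, hy]
    rw [Finsupp.sum, Finsupp.sum, ← Finset.sum_sub_distrib, hsum]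
    refine Finset.sum_le_sum fun i hi => ?_
    rw [← mul_sub]
    exact mul_le_mul_of_nonneg_left
      (h.siteDrift_sub_le_of_common hf hn hfK hy (mem_support_iff.1 hi) a b) (Nat.cast_nonneg _)
  have hlast := h.siteDrift_sub_le_of_ne hf hpm0 hpm hn hfK hy hab
  have hP : (n : ℝ) * (P / n * K) = P * K := by
    field_simp
  rw [drift_add_single, drift_add_single]
  linarith

end Drift

/-! ### Rates of the Fleming–Viot process -/

section Rates

variable {F : Type*} {Q : F → F → ℝ} {p₀ : F → ℝ}

open Classical in
/-- The jump rates with the diagonal, which is arbitrary in `Q`, replaced by `0`. -/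
noncomputable def offDiag (Q : F → F → ℝ) (i j : F) : ℝ := if i = j then 0 else Q i j

theorem offDiag_self (Q : F → F → ℝ) (i : F) : offDiag Q i i = 0 := by simp [offDiag]

theorem offDiag_of_ne (Q : F → F → ℝ) {i j : F} (h : i ≠ j) : offDiag Q i j = Q i j := by
  simp [offDiag, h]

theorem offDiag_nonneg (hQ : ∀ i j, i ≠ j → 0 ≤ Q i j) (i j : F) : 0 ≤ offDiag Q i j := by
  unfold offDiag
  split_ifs with h
  exacts [le_rfl, hQ i j h]

theorem support_offDiag_subset (Q : F → F → ℝ) (i : F) :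
    Function.support (offDiag Q i) ⊆ {j | j ≠ i} := fun j hj hji => by
  subst hji
  exact hj (offDiag_self Q j)

theorem tsum_offDiag (Q : F → F → ℝ) (i : F) : ∑' j, offDiag Q i j = exitRate Q i := by
  rw [← tsum_subtype_eq_of_support_subset (support_offDiag_subset Q i)]
  exact tsum_congr fun j => offDiag_of_ne Q j.2.symm

theorem BoundedRates.rateBounds (hA : BoundedRates Q p₀) (hQ : ∀ i j, i ≠ j → 0 ≤ Q i j)
    (hp₀ : ∀ i, 0 ≤ p₀ i) : RateBounds (offDiag Q) p₀ (Q₁ Q) (⨆ i, p₀ i) where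
  nonneg := offDiag_nonneg hQ
  diag := offDiag_self Q
  summable i := by
    rw [← Set.indicator_eq_self.2 (support_offDiag_subset Q i), ← summable_subtype_iff_indicator]
    exact (hA.summable i).congr fun j => (offDiag_of_ne Q j.2.symm).symm
  tsum_le i := by
    rw [tsum_offDiag]
    exact le_ciSup hA.exitRate_bdd i
  death_nonneg := hp₀
  death_le i := le_ciSup hA.death_bdd i

/-- Taking `offDiag Q` makes the terms `j = a` and `j = b` vanish, so the sum may run over all
`j`. -/
theorem mixingRate_le (hQ : ∀ i j, i ≠ j → 0 ≤ Q i j) {a b : F} (hab : a ≠ b) :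
    mixingRate Q ≤
      offDiag Q a b + offDiag Q b a + ∑' j, min (offDiag Q a j) (offDiag Q b j) := by
  have hbdd : BddBelow (Set.range fun x : {x : F × F // x.1 ≠ x.2} =>
      Q x.1.1 x.1.2 + Q x.1.2 x.1.1 +
        ∑' j : {j : F // j ≠ x.1.1 ∧ j ≠ x.1.2}, min (Q x.1.1 j) (Q x.1.2 j)) := by
    refine ⟨0, ?_⟩
    rintro _ ⟨x, rfl⟩
    exact add_nonneg (add_nonneg (hQ _ _ x.2) (hQ _ _ x.2.symm))
      (tsum_nonneg fun j => le_min (hQ _ _ j.2.1.symm) (hQ _ _ j.2.2.symm))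
  refine (ciInf_le hbdd ⟨(a, b), hab⟩).trans_eq ?_
  have hsupp : Function.support (fun j => min (offDiag Q a j) (offDiag Q b j)) ⊆
      {j | j ≠ a ∧ j ≠ b} := by
    intro j hj
    refine ⟨?_, ?_⟩
    · rintro rfl
      exact hj (by simp only [offDiag_self, min_eq_left (offDiag_nonneg hQ b j)])
    · rintro rfl
      exact hj (by simp only [offDiag_self, min_eq_right (offDiag_nonneg hQ a j)])
  rw [offDiag_of_ne Q hab, offDiag_of_ne Q hab.symm, ← tsum_subtype_eq_of_support_subset hsupp]
  congr 1
  exact tsum_congr fun j => by rw [offDiag_of_ne Q j.2.1.symm, offDiag_of_ne Q j.2.2.symm]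

end Rates

/-! ### The generator as a bounded operator -/

section Generator

variable {F : Type*} {Q : F → F → ℝ} {p₀ : F → ℝ} {n : ℕ}

/-- The extension by `0` of a function of configurations to all finitely supported functions. -/
noncomputable def extend {N : ℕ} (f : Config F N → ℝ) (x : F →₀ ℕ) : ℝ :=
  if h : x.degree = N then f ⟨x, h⟩ else 0

theorem extend_coe {N : ℕ} (f : Config F N → ℝ) (ξ : Config F N) : extend f ξ.1 = f ξ :=
  dif_pos ξ.2

theorem abs_extend_le {N : ℕ} {f : Config F N → ℝ} {C : ℝ} (hC : 0 ≤ C) (hf : ∀ ξ, |f ξ| ≤ C)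
    (x : F →₀ ℕ) : |extend f x| ≤ C := by
  unfold extend
  split_ifs
  exacts [hf _, by simpa using hC]

theorem extend_add {N : ℕ} (f g : Config F N → ℝ) :
    extend (fun ξ => f ξ + g ξ) = fun x => extend f x + extend g x := by
  ext x
  unfold extend
  split_ifs <;> simp

theorem extend_mul {N : ℕ} (f g : Config F N → ℝ) :
    extend (fun ξ => f ξ * g ξ) = fun x => extend f x * extend g x := by
  ext x
  unfold extend
  split_ifs <;> simp

theorem extend_const_mul {N : ℕ} (r : ℝ) (f : Config F N → ℝ) :
    extend (fun ξ => r * f ξ) = fun x => r * extend f x := by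
  ext x
  unfold extend
  split_ifs <;> simp

theorem generator_eq_drift (Q : F → F → ℝ) (p₀ : F → ℝ) (f : Config F (n + 1) → ℝ)
    (ξ : Config F (n + 1)) :
    generator Q p₀ f ξ = drift (offDiag Q) p₀ n (extend f) ξ.1 := by
  refine Finset.sum_congr rfl fun i hi => ?_
  change (ξ.1 i : ℝ) * _ = (ξ.1 i : ℝ) * siteDrift _ _ _ _ _ _
  rw [siteDrift]
  refine congrArg _ (tsum_congr fun j => ?_)
  have hi' : ξ.1 i ≠ 0 := mem_support_iff.1 hi
  have hmove : extend f (ξ.1 - single i 1 + single j 1) = f (move i j ξ) := by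
    have h : (move i j ξ).1 = ξ.1 - single i 1 + single j 1 := by
      rw [move, dif_neg hi']
    rw [← h, extend_coe]
  rw [hmove, extend_coe]
  by_cases hij : i = j
  · subst hij
    have : move i i ξ = ξ := by
      rw [move, dif_neg hi']
      exact Subtype.ext (sub_add_cancel_single hi')
    simp [this]
  · rw [jumpRate, offDiag_of_ne Q hij]
    push_cast
    rw [add_sub_cancel_right]

variable [TopologicalSpace (Config F (n + 1))]

theorem abs_extend_le_norm (f : Config F (n + 1) →ᵇ ℝ) (x : F →₀ ℕ) : |extend f x| ≤ ‖f‖ :=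
  abs_extend_le (norm_nonneg f) f.norm_coe_le_norm x

theorem abs_generator_le {B P : ℝ} (h : RateBounds (offDiag Q) p₀ B P) (hn : 0 < n)
    (f : Config F (n + 1) →ᵇ ℝ) (ξ : Config F (n + 1)) :
    |generator Q p₀ f ξ| ≤
      ((n + 1 : ℕ) : ℝ) * (2 * (B + P * (((n + 1 : ℕ) : ℝ) / n))) * ‖f‖ := by
  rw [generator_eq_drift]
  refine (h.abs_drift_le (by exact_mod_cast hn) (abs_extend_le_norm f) ξ.1).trans_eq ?_
  rw [show ξ.1.degree = n + 1 from ξ.2]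
  ring

variable [DiscreteTopology (Config F (n + 1))]

/-- The generator, as a bounded operator on bounded functions. -/
noncomputable def generatorCLM {B P : ℝ} (h : RateBounds (offDiag Q) p₀ B P) (hn : 0 < n) :
    (Config F (n + 1) →ᵇ ℝ) →L[ℝ] (Config F (n + 1) →ᵇ ℝ) :=
  LinearMap.mkContinuousOfExistsBound
    { toFun := fun f => BoundedContinuousFunction.ofNormedAddCommGroupDiscrete
        (generator Q p₀ f) _ (abs_generator_le h hn f)
      map_add' := fun f g => by
        ext ξ
        have hc : (0 : ℝ) < n := by exact_mod_cast hn
        have := h.drift_add hc (abs_extend_le_norm f) (abs_extend_le_norm g) ξ.1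
        rw [← extend_add] at this
        simp only [← generator_eq_drift] at this
        exact this
      map_smul' := fun r f => by
        ext ξ
        have := drift_const_mul (q := offDiag Q) (p := p₀) (c := n) r (extend f) ξ.1
        rw [← extend_const_mul] at this
        simp only [← generator_eq_drift] at this
        exact this }
    ⟨((n + 1 : ℕ) : ℝ) * (2 * (|B| + |P| * (((n + 1 : ℕ) : ℝ) / n))), fun f =>
      (BoundedContinuousFunction.norm_le (by positivity)).2 fun ξ =>
        (abs_generator_le h hn f ξ).trans (by gcongr <;> exact le_abs_self _)⟩

theorem generatorCLM_apply {B P : ℝ} (h : RateBounds (offDiag Q) p₀ B P) (hn : 0 < n)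
    (f : Config F (n + 1) →ᵇ ℝ) (ξ : Config F (n + 1)) :
    generatorCLM h hn f ξ = generator Q p₀ f ξ := rfl

theorem norm_carreDuChamp_le {B P : ℝ} (h : RateBounds (offDiag Q) p₀ B P) (hn : 0 < n)
    {u v : Config F (n + 1) →ᵇ ℝ} {K : ℝ} (hK : 0 ≤ K) (hu : MoveLipschitz (extend u) n K)
    (hv : MoveLipschitz (extend v) n K) (hBP : 0 ≤ B + P * ((n + 1 : ℝ) / n)) :
    ‖carreDuChamp (generatorCLM h hn) u v‖ ≤ (n + 1) * (K * K * (B + P * ((n + 1 : ℝ) / n))) := by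
  refine (BoundedContinuousFunction.norm_le (by positivity)).2 fun ξ => ?_
  have := h.abs_drift_mul_le (c := n) (by exact_mod_cast hn) (abs_extend_le_norm u)
    (abs_extend_le_norm v) hu hv hK hK (x := ξ.1) ξ.2
  rw [← extend_mul, extend_coe, extend_coe, show ξ.1.degree = n + 1 from ξ.2] at this
  push_cast at this
  refine le_trans (le_of_eq ?_) this
  simp only [← generator_eq_drift]
  rfl

/-- The semigroup contracts the one-move Lipschitz constant at rate `rho`. -/
theorem moveLipschitz_semigroup (hA : BoundedRates Q p₀) (hQ : ∀ i j, i ≠ j → 0 ≤ Q i j)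
    (hp₀ : ∀ i, 0 ≤ p₀ i) (hn : 0 < n) {u : Config F (n + 1) →ᵇ ℝ} {K : ℝ} (hK : 0 ≤ K)
    (hu : MoveLipschitz (extend u) n K) {t : ℝ} (ht : 0 ≤ t) :
    MoveLipschitz (extend (semigroup (generatorCLM (hA.rateBounds hQ hp₀) hn) t u)) n
      (Real.exp (-rho Q p₀ * t) * K) := by
  set h := hA.rateBounds hQ hp₀
  have hdeg : ∀ y : F →₀ ℕ, y.degree = n → ∀ a, (y + single a 1).degree = n + 1 :=
    fun y hy a => by simp [hy]
  let ev : {x : (F →₀ ℕ) × F // x.1.degree = n} → (Config F (n + 1) →ᵇ ℝ) →L[ℝ] ℝ := fun x =>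
    BoundedContinuousFunction.evalCLM ℝ ⟨x.1.1 + single x.1.2 1, hdeg _ x.2 _⟩
  have hev : ∀ y (hy : y.degree = n) a (w : Config F (n + 1) →ᵇ ℝ),
      ev ⟨(y, a), hy⟩ w = extend w (y + single a 1) := fun y hy a w =>
    (extend_coe w ⟨y + single a 1, hdeg y hy a⟩).symm
  -- The differences across one move. Pairs with `a = b` are excluded, since the contraction
  -- estimate needs the mixing rate of two distinct sites.
  let d : {x : (F →₀ ℕ) × F × F // x.1.degree = n ∧ x.2.1 ≠ x.2.2} →
      (Config F (n + 1) →ᵇ ℝ) →L[ℝ] ℝ := fun x =>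
    ev ⟨(x.1.1, x.1.2.1), x.2.1⟩ - ev ⟨(x.1.1, x.1.2.2), x.2.1⟩
  have hd : ∀ y (hy : y.degree = n) a b (hab : a ≠ b) (w : Config F (n + 1) →ᵇ ℝ),
      d ⟨(y, a, b), hy, hab⟩ w = extend w (y + single a 1) - extend w (y + single b 1) :=
    fun y hy a b hab w => by
      rw [← hev y hy a, ← hev y hy b]
      rfl
  have hlip : ∀ (w : Config F (n + 1) →ᵇ ℝ) K, 0 ≤ K → (∀ i, d i w ≤ K) →
      MoveLipschitz (extend w) n K := by
    intro w K hK hw y hy a b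
    by_cases hab : a = b
    · subst hab
      simpa using hK
    · rw [← hd y hy a b hab]
      exact hw _
  have hgen : ∀ w K, (∀ i, d i w ≤ K) → ∀ i, d i (generatorCLM h hn w)
      + (n * (Q₁ Q + (⨆ i, p₀ i) + (⨆ i, p₀ i) / n) + (2 * Q₁ Q + 2 * ⨆ i, p₀ i)) * d i w ≤
      (n * (Q₁ Q + (⨆ i, p₀ i) + (⨆ i, p₀ i) / n) + (2 * Q₁ Q + 2 * ⨆ i, p₀ i)
        - rho Q p₀) * K := by
    rintro w K hw ⟨⟨y, a, b⟩, hy, hab⟩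
    -- The family `d` is symmetric, so a common upper bound is nonnegative.
    have hK : 0 ≤ K := by
      have h1 := hw ⟨(y, a, b), hy, hab⟩
      have h2 := hw ⟨(y, b, a), hy, hab.symm⟩
      rw [hd y hy a b hab] at h1
      rw [hd y hy b a hab.symm] at h2
      linarith
    have hinf : ∀ i, ⨅ i, p₀ i ≤ p₀ i :=
      fun i => ciInf_le ⟨0, by rintro _ ⟨j, rfl⟩; exact hp₀ j⟩ i
    have hmain := h.drift_sub_add_le (abs_extend_le_norm w) (Real.iInf_nonneg hp₀) hinf hn
      (hlip w K hK hw) hy hab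
    have hL : ∀ a, extend (generatorCLM h hn w) (y + single a 1)
        = drift (offDiag Q) p₀ n (extend w) (y + single a 1) := fun a => by
      rw [← generator_eq_drift Q p₀ w ⟨y + single a 1, hdeg y hy a⟩]
      exact extend_coe (generatorCLM h hn w) ⟨y + single a 1, hdeg y hy a⟩
    rw [hd y hy a b hab, hd y hy a b hab, hL, hL]
    refine hmain.trans (mul_le_mul_of_nonneg_right ?_ hK)
    rw [rho]
    linarith [mixingRate_le hQ hab]
  have hd_u : ∀ i, d i u ≤ K := by
    rintro ⟨⟨y, a, b⟩, hy, hab⟩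
    rw [hd y hy a b hab]
    exact hu y hy a b
  exact hlip _ _ (by positivity) fun i =>
    semigroup_le_of_forall_generator_le (generatorCLM h hn) d _ (rho Q p₀) hgen hd_u ht i

/-- The proportion of particles at the site `k`. -/
noncomputable def density (k : F) : Config F (n + 1) →ᵇ ℝ :=
  BoundedContinuousFunction.ofNormedAddCommGroupDiscrete
    (fun ξ => (ξ.1 k : ℝ) / ((n + 1 : ℕ) : ℝ)) 1 fun ξ => by
      rw [Real.norm_of_nonneg (by positivity)]
      refine div_le_one_of_le₀ ?_ (by positivity)
      exact_mod_cast (le_degree k ξ.1).trans_eq ξ.2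

theorem density_apply (k : F) (ξ : Config F (n + 1)) :
    density k ξ = (ξ.1 k : ℝ) / ((n + 1 : ℕ) : ℝ) := rfl

theorem moveLipschitz_density (k : F) :
    MoveLipschitz (extend (density (n := n) k)) n (1 / ((n + 1 : ℕ) : ℝ)) := by
  classical
  intro y hy a b
  have hext : ∀ a, extend (density (n := n) k) (y + single a 1)
      = ((y + single a 1 : F →₀ ℕ) k : ℝ) / ((n + 1 : ℕ) : ℝ) := fun a =>
    extend_coe (density k) ⟨y + single a 1, show (y + single a 1).degree = n + 1 by simp [hy]⟩
  rw [hext, hext, ← sub_div]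
  refine div_le_div_of_nonneg_right ?_ (by positivity)
  simp only [Finsupp.add_apply, single_apply, Nat.cast_add]
  split_ifs <;> simp

end Generator

end FlemingViot

theorem mainTheorem3 {F : Type*} [Countable F] (Q : F → F → ℝ) (p₀ : F → ℝ)
    (hQ : ∀ i j : F, i ≠ j → 0 ≤ Q i j) (hp₀ : ∀ i : F, 0 ≤ p₀ i)
    (hA : FlemingViot.BoundedRates Q p₀) (N : ℕ) (hN : 2 ≤ N)
    {Ω : Type*} [mΩ : MeasurableSpace Ω] (μ : Measure Ω) [IsProbabilityMeasure μ]
    (ℱ : Filtration ℝ≥0 mΩ) (η : ℝ≥0 → Ω → FlemingViot.Config F N)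
    (η₀ : FlemingViot.Config F N) (hη : FlemingViot.IsProcess Q p₀ μ ℱ η η₀)
    (k l : F) (t : ℝ≥0) :
    |(∫ ω, ((η t ω).1 k : ℝ) / N * (((η t ω).1 l : ℝ) / N) ∂μ)
        - (∫ ω, ((η t ω).1 k : ℝ) / N ∂μ) * (∫ ω, ((η t ω).1 l : ℝ) / N ∂μ)|
      ≤ 2 * (FlemingViot.Q₁ Q + ⨆ i : F, p₀ i) / ((N : ℝ) - 1)
        * FlemingViot.timeFactor (FlemingViot.rho Q p₀) t := by
  open FlemingViot in
  obtain ⟨n, rfl⟩ : ∃ n, N = n + 1 := ⟨N - 1, by omega⟩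
  have hn : 0 < n := by omega
  have hn1 : (1 : ℝ) ≤ n := by exact_mod_cast hn
  -- With the discrete topology, bounded continuous functions are all bounded functions.
  let _ : TopologicalSpace (Config F (n + 1)) := ⊥
  have _ : DiscreteTopology (Config F (n + 1)) := ⟨rfl⟩
  have h := hA.rateBounds hQ hp₀
  set L := generatorCLM (hA.rateBounds hQ hp₀) hn
  have hB : 0 ≤ Q₁ Q := (tsum_nonneg (h.nonneg k)).trans (h.tsum_le k)
  have hP : 0 ≤ ⨆ i, p₀ i := (hp₀ k).trans (h.death_le k)
  have hlaw := hη.integral_comp_eq_semigroup L (generatorCLM_apply _ hn)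
  have hcov := abs_covariance_le L (BoundedContinuousFunction.evalCLM ℝ η₀) (fun u v => rfl)
    (C := (Q₁ Q + (⨆ i, p₀ i) * ((n + 1 : ℝ) / n)) / (n + 1)) (ρ := rho Q p₀) t.coe_nonneg
    (fun s hs g => by
      have := norm_integral_le_of_norm_le_const (μ := μ) (f := fun ω => g (η s.toNNReal ω))
        (C := ‖g‖) (Eventually.of_forall fun ω => g.norm_coe_le_norm _)
      rw [hlaw, Real.coe_toNNReal _ hs] at this
      simpa using this)
    (u := density k) (v := density l)
    (fun s hs => by
      have hlip := fun k => moveLipschitz_semigroup hA hQ hp₀ hn (by positivity)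
        (moveLipschitz_density k) hs
      refine (norm_carreDuChamp_le _ hn (by positivity) (hlip k) (hlip l)
        (by positivity)).trans_eq ?_
      have he : Real.exp (-2 * rho Q p₀ * s)
          = Real.exp (-rho Q p₀ * s) * Real.exp (-rho Q p₀ * s) := by
        rw [← Real.exp_add]
        congr 1
        ring
      rw [he]
      push_cast
      field_simp)
  have e1 := hlaw t (density k * density l)
  have e2 := hlaw t (density k)
  have e3 := hlaw t (density l)
  simp only [BoundedContinuousFunction.mul_apply, density_apply] at e1 e2 e3
  rw [e1, e2, e3]
  refine hcov.trans (mul_le_mul_of_nonneg_right ?_ (timeFactor_nonneg _ t.coe_nonneg))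
  push_cast
  rw [add_sub_cancel_right]
  have hn0 : (0 : ℝ) < n := by linarith
  have h2 : ((n : ℝ) + 1) / n ≤ 2 := by
    rw [div_le_iff₀ hn0]
    linarith
  -- The constant obtained is smaller than the one claimed, by a factor of at least `2`.
  calc (Q₁ Q + (⨆ i, p₀ i) * ((n + 1 : ℝ) / n)) / (n + 1) / 2
      ≤ (Q₁ Q + (⨆ i, p₀ i) * 2) / n / 2 := by gcongr; linarith
    _ = (Q₁ Q + (⨆ i, p₀ i) * 2) / 2 / n := by ring
    _ ≤ 2 * (Q₁ Q + ⨆ i, p₀ i) / n := by gcongr; linarith
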